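/- Let $N\ge 1$ and consider a system of $N$ parties with local Hilbert spaces $\mathbb C^{D_1},\dots,\mathbb C^{D_N}$, $D_j\ge 2$. For a pure state $\rho=|\psi\rangle\langle\psi|$, $\|\psi\|=1$, and $1\le j\le N$, let $\mathcal M$ range over the complete projective measurements on the rest of party $j$, i.e. over the families $\mathcal P_i=\mathbb I^{(j)}\otimes|\chi_i\rangle\langle\chi_i|$ with $(\chi_i)$ an orthonormal basis of the Hilbert space of the other $N-1$ parties; let $p_i=\operatorname{Tr}(\rho\mathcal P_i)$ and $\rho_i=\mathcal P_i\rho\mathcal P_i/p_i$. Let $\Omega_j$ be the set of observables $O=A\otimes\mathbb I$ with $A$ a Hermitian operator on $\mathbb C^{D_j}$ such that $\operatorname{Tr}A=0$ and $A$ is normalised in the trace (Hilbert–Schmidt) norm, $\operatorname{Tr}A^2=1$. Put $$\mathcal E^{(j)}_{\mathcal M}(\rho)=\sum_i p_i\max_{O\in\Omega_j}\bigl(\operatorname{Tr}\rho O-\operatorname{Tr}\rho_iO\bigr)^2,\qquad E^{(j)}(\rho)=\max_{\mathcal M}\mathcal E^{(j)}_{\mathcal M}(\rho),$$ and define the General Entanglement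 $E_g(\rho)=\frac1N\sum_jE^{(j)}(\rho)$ and the normalised General Entanglement $\tilde E_g(\rho)=\frac1N\sum_j\bigl(1-\frac1{D_j}\bigr)^{-1}E^{(j)}(\rho)$. Then the maxima exist, and both $E_g$ and $\tilde E_g$ are monotone under LOCC. Here an LOCC protocol consists of finitely many rounds; in each round every party performs a local generalised measurement (finitely many Kraus operators $K_a$ with $\sum_aK_a^\dagger K_a=\mathbb I$, possibly with ancillas, so that local dimensions may change during the protocol but are $D_1,\dots,D_N$ again at the end), all results are communicated, and later rounds may depend on all earlier results; results may be forgotten at the end. That is, for $E\in\{E_g,\tilde E_g\}$: 1. if an LOCC protocol transforms $|\psi\rangle\langle\psi|$ into the pure state $|\varphi\rangle\langle\varphi|$ with certainty, then $E(|\varphi\rangle\langle\varphi|)\le E(|\psi\rangle\langle\psi|)$; 2. if an LOCC protocol transforms $|\psi\rangle\langle\psi|$ into the pure state $|\varphi_x\rangle\langle\varphi_x|$ with probability $p_x$, where $x$ is its final classical outcome in a finite set, then $\sum_xp_x\,E(|\varphi_x\rangle\langle\varphi_x|)\le E(|\psi\rangle\langle\psi|)$. -/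

import Mathlib

open Matrix

noncomputable section

namespace GenEnt

/-- Labels of the product basis of `⨂ j, ℂ ^ (d j)`. The Hilbert space of the `N`-partite system
with local dimensions `d` is `EuclideanSpace ℂ (Config d)`. -/
abbrev Config {N : ℕ} (d : Fin N → ℕ) : Type := (j : Fin N) → Fin (d j)

/-- Labels of the product basis of the system obtained by leaving out subsystem `j`. -/
abbrev RestConfig {N : ℕ} (d : Fin N → ℕ) (j : Fin N) : Type :=
  (i : {i : Fin N // i ≠ j}) → Fin (d i)

/-- The part of a product basis label that belongs to the subsystems other than `j`. -/
def rest {N : ℕ} {d : Fin N → ℕ} (j : Fin N) (x : Config d) : RestConfig d j := fun i => x i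

/-- `A ⊗ 𝟙`, where `A` acts on subsystem `j` and `𝟙` on the rest. -/
def onParty {N : ℕ} {d : Fin N → ℕ} (j : Fin N) (A : Matrix (Fin (d j)) (Fin (d j)) ℂ) :
    Matrix (Config d) (Config d) ℂ :=
  Matrix.of fun x y => if rest j x = rest j y then A (x j) (y j) else 0

/-- `𝟙 ⊗ B`, where `𝟙` acts on subsystem `j` and `B` on the rest. -/
def onRest {N : ℕ} {d : Fin N → ℕ} (j : Fin N)
    (B : Matrix (RestConfig d j) (RestConfig d j) ℂ) :
    Matrix (Config d) (Config d) ℂ :=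
  Matrix.of fun x y => if x j = y j then B (rest j x) (rest j y) else 0

/-- `|v⟩⟨v|`. -/
def ketbra {α : Type} (v : EuclideanSpace ℂ α) : Matrix α α ℂ :=
  Matrix.vecMulVec (fun x => v x) (fun x => star (v x))

/-- A complete (rank-one) projective measurement on the rest of subsystem `j`: an orthonormal
basis `χ` of the Hilbert space of the rest; the outcome `i` belongs to the vector `χ i`. -/
abbrev RestMeasurement {N : ℕ} (d : Fin N → ℕ) (j : Fin N) : Type :=
  OrthonormalBasis (RestConfig d j) ℂ (EuclideanSpace ℂ (RestConfig d j))

/-- The projector `𝟙 ⊗ |χ i⟩⟨χ i|`. -/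
def projector {N : ℕ} {d : Fin N → ℕ} {j : Fin N} (χ : RestMeasurement d j)
    (i : RestConfig d j) : Matrix (Config d) (Config d) ℂ :=
  onRest j (ketbra (χ i))

/-- The probability of the outcome `i` in the state `ρ`. -/
def outcomeProb {N : ℕ} {d : Fin N → ℕ} {j : Fin N} (ρ : Matrix (Config d) (Config d) ℂ)
    (χ : RestMeasurement d j) (i : RestConfig d j) : ℝ :=
  (ρ * projector χ i).trace.re

/-- The state after the outcome `i`. -/
def postState {N : ℕ} {d : Fin N → ℕ} {j : Fin N} (ρ : Matrix (Config d) (Config d) ℂ)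
    (χ : RestMeasurement d j) (i : RestConfig d j) : Matrix (Config d) (Config d) ℂ :=
  (outcomeProb ρ χ i)⁻¹ • (projector χ i * ρ * projector χ i)

/-- Traceless observables of subsystem `j` that are normalised in the norm of the trace scalar
product, `‖A‖² = Tr A²`. -/
def observables {N : ℕ} (d : Fin N → ℕ) (j : Fin N) :
    Set (Matrix (Fin (d j)) (Fin (d j)) ℂ) :=
  {A | A.IsHermitian ∧ A.trace = 0 ∧ (A * A).trace = 1}

/-- `R = (Tr ρ O - Tr ρᵢ O)²` with `O = A ⊗ 𝟙`. -/
def disturbance {N : ℕ} {d : Fin N → ℕ} {j : Fin N} (ρ : Matrix (Config d) (Config d) ℂ)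
    (χ : RestMeasurement d j) (i : RestConfig d j)
    (A : Matrix (Fin (d j)) (Fin (d j)) ℂ) : ℝ :=
  ((ρ * onParty j A).trace.re - (postState ρ χ i * onParty j A).trace.re) ^ 2

/-- The average departure from separability, `∑ᵢ pᵢ max_O R`. -/
def departure {N : ℕ} {d : Fin N → ℕ} {j : Fin N} (ρ : Matrix (Config d) (Config d) ℂ)
    (χ : RestMeasurement d j) : ℝ :=
  ∑ i, outcomeProb ρ χ i * ⨆ A : observables d j, disturbance ρ χ i A

/-- General Entanglement. -/
def generalEntanglement {N : ℕ} {d : Fin N → ℕ} (ρ : Matrix (Config d) (Config d) ℂ) : ℝ :=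
  (1 / (N : ℝ)) * ∑ j : Fin N, ⨆ χ : RestMeasurement d j, departure ρ χ

/-- Normalised General Entanglement: the contribution of subsystem `j` is divided by
`1 - 1 / d j`. -/
def normalizedGeneralEntanglement {N : ℕ} {d : Fin N → ℕ}
    (ρ : Matrix (Config d) (Config d) ℂ) : ℝ :=
  (1 / (N : ℝ)) * ∑ j : Fin N,
    (1 - 1 / (d j : ℝ))⁻¹ * ⨆ χ : RestMeasurement d j, departure ρ χ

/-- The maxima in the definition of General Entanglement are attained at `ρ`. -/
def MaximaAttained {N : ℕ} {d : Fin N → ℕ} (ρ : Matrix (Config d) (Config d) ℂ) : Prop :=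
  ∀ j : Fin N,
    (∀ (χ : RestMeasurement d j) (i : RestConfig d j),
      ∃ A ∈ observables d j, ∀ B ∈ observables d j,
        disturbance ρ χ i B ≤ disturbance ρ χ i A) ∧
    (∃ χ : RestMeasurement d j, ∀ χ' : RestMeasurement d j, departure ρ χ' ≤ departure ρ χ)

/-- The tensor product `⨂ j, A j` of local operators. -/
def tensorOp {N : ℕ} {d m : Fin N → ℕ} (A : (j : Fin N) → Matrix (Fin (m j)) (Fin (d j)) ℂ) :
    Matrix (Config m) (Config d) ℂ :=
  Matrix.of fun x y => ∏ j, A j (x j) (y j)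

/-- LOCC protocols with finitely many rounds on systems with local dimensions `d` (the last
index), with final local dimensions `e` and final classical outcome in `X`.

Either the protocol stops and reports a classical outcome, or every party `j` performs a local
generalised measurement with Kraus operators `K j a`, all the results are communicated, and the
protocol goes on in a way that may depend on all of them. A party that does nothing in a round
uses the single Kraus operator `1`. The dimensions may change on the way (local ancillas), and
results may be forgotten, as different branches may report the same outcome in `X`. -/
inductive LOCC {N : ℕ} (X : Type) (e : Fin N → ℕ) : (Fin N → ℕ) → Type
  | done (x : X) : LOCC X e e
  | round {d : Fin N → ℕ} (m n : Fin N → ℕ)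
      (K : (j : Fin N) → Fin (n j) → Matrix (Fin (m j)) (Fin (d j)) ℂ)
      (complete : ∀ j, ∑ a, (K j a)ᴴ * K j a = 1)
      (next : ((j : Fin N) → Fin (n j)) → LOCC X e m) : LOCC X e d

/-- The unnormalised output of a protocol on the input `ρ` for the final outcome `x`: the sum of
`M ρ Mᴴ` over the branches that report `x`, where `M` is the product of the operators along the
branch. Its trace is the probability of `x`. -/
def LOCC.output {N : ℕ} {X : Type} [DecidableEq X] {e d : Fin N → ℕ} (P : LOCC X e d) (x : X)
    (ρ : Matrix (Config d) (Config d) ℂ) : Matrix (Config e) (Config e) ℂ :=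
  match P with
  | .done y => if y = x then ρ else 0
  | .round _ _ K _ next =>
      ∑ a, (next a).output x
        (tensorOp (fun j => K j (a j)) * ρ * (tensorOp (fun j => K j (a j)))ᴴ)

end GenEnt

end

/-! Let `Ψ` be the coefficient matrix of a unit vector for the cut between party `j` and the rest,
and `σ = ΨΨᴴ` the reduced state. An outcome `i` on the rest leaves party `j` in a pure state `σᵢ`.
As `σ - σᵢ` is Hermitian and traceless, Cauchy–Schwarz makes the best squared response `Tr (σ -
σᵢ)²`. Since `∑ pᵢ σᵢ = σ`, the average is `1 - Tr σ²` for every measurement (`departure_ketbra`).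
Both entanglement measures are therefore nonnegative combinations of linear entropies.

Extended to unnormalised vectors as `Tr σ - Tr σ² / Tr σ`, the linear entropy decreases on average
under local Kraus operators: those of the rest split `σ` into a sum, on which `Tr σ² / Tr σ` is
subadditive (`trace_sq_div_trace_sum_le`), and those of party `j` reduce to this case by exchanging
`Ψ` and `Ψᴴ`. Induction over the rounds bounds the average over branches. Forgetting results does no
harm, because an ensemble realising a pure state contains only multiples of it
(`exists_smul_of_sum_ketbra`). -/

noncomputable section

namespace GenEnt

/-! ### Linear entropy under one-sided measurements -/

section Trace

open scoped ComplexOrder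

variable {α β ι : Type*} [Fintype α] [Fintype β] [Fintype ι]

theorem trace_mul_self_re_nonneg {H : Matrix α α ℂ} (hH : H.IsHermitian) :
    0 ≤ (H * H).trace.re := by
  have h := (posSemidef_conjTranspose_mul_self H).trace_nonneg
  rw [hH.eq] at h
  exact (Complex.le_def.1 h).1

theorem trace_mul_self_re_eq_sum {H : Matrix α α ℂ} (hH : H.IsHermitian) :
    (H * H).trace.re = ∑ p : α × α, ‖H p.1 p.2‖ ^ 2 := by
  rw [Fintype.sum_prod_type, trace, Complex.re_sum]
  refine Finset.sum_congr rfl fun x _ => ?_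
  rw [diag_apply, mul_apply, Complex.re_sum]
  refine Finset.sum_congr rfl fun y _ => ?_
  rw [← hH.apply y x, Complex.star_def, Complex.mul_conj, Complex.ofReal_re,
    Complex.normSq_eq_norm_sq]

theorem trace_eq_ofReal_re {H : Matrix α α ℂ} (hH : H.IsHermitian) :
    H.trace = (H.trace.re : ℂ) := by
  have h := trace_conjTranspose H
  rw [hH.eq] at h
  exact (Complex.conj_eq_iff_re.1 h.symm).symm

/-- The ratio `Tr σ² / Tr σ` is subadditive on positive semidefinite matrices. -/
theorem trace_sq_div_trace_sum_le (σ : ι → Matrix α α ℂ) (hσ : ∀ i, (σ i).PosSemidef) :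
    ((∑ i, σ i) * ∑ i, σ i).trace.re / (∑ i, σ i).trace.re ≤
      ∑ i, (σ i * σ i).trace.re / (σ i).trace.re := by
  have tnn : ∀ i, 0 ≤ (σ i).trace.re := fun i => (Complex.le_def.1 (hσ i).trace_nonneg).1
  have qnn : ∀ i, 0 ≤ (σ i * σ i).trace.re := fun i => trace_mul_self_re_nonneg (hσ i).isHermitian
  have hsum : (∑ i, σ i).trace.re = ∑ i, (σ i).trace.re := by
    rw [trace_sum, Complex.re_sum]
  have hherm : (∑ i, σ i).IsHermitian := (posSemidef_sum _ fun i _ => hσ i).isHermitian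
  let v : Matrix α α ℂ → EuclideanSpace ℂ (α × α) := fun A => WithLp.toLp 2 fun p => A p.1 p.2
  have hv : ∀ {H : Matrix α α ℂ}, H.IsHermitian → ‖v H‖ ^ 2 = (H * H).trace.re := fun hH => by
    rw [EuclideanSpace.norm_sq_eq, trace_mul_self_re_eq_sum hH]
  have hvs : v (∑ i, σ i) = ∑ i, v (σ i) := by
    ext p
    simp [v, Matrix.sum_apply]
  refine div_le_of_le_mul₀ (hsum ▸ Finset.sum_nonneg fun i _ => tnn i)
    (Finset.sum_nonneg fun i _ => div_nonneg (qnn i) (tnn i)) ?_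
  -- Triangle inequality for the Hilbert–Schmidt norm, then Cauchy–Schwarz with `‖σᵢ‖² = (‖σᵢ‖² / Tr
  -- σᵢ) · Tr σᵢ`.
  rw [← hv hherm, hvs, hsum]
  refine (pow_le_pow_left₀ (norm_nonneg _) (norm_sum_le _ _) 2).trans ?_
  refine Finset.sum_sq_le_sum_mul_sum_of_sq_le_mul _ (fun i _ => div_nonneg (qnn i) (tnn i))
    (fun i _ => tnn i) fun i _ => le_of_eq ?_
  rw [hv (hσ i).isHermitian]
  -- Division by zero is harmless: a positive semidefinite matrix of trace zero vanishes.
  by_cases h : (σ i).trace.re = 0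
  · have : (σ i).trace = 0 :=
      Complex.ext h (Complex.le_def.1 (hσ i).trace_nonneg).2.symm
    rw [(hσ i).trace_eq_zero_iff.1 this]
    simp
  · rw [div_mul_cancel₀ _ h]

/-- The linear entropy `‖Ψ‖² - Tr (Ψ Ψᴴ)² / ‖Ψ‖²` of the (unnormalised) bipartite pure state with
coefficient matrix `Ψ`. -/
def linearEntropy (Ψ : Matrix α β ℂ) : ℝ :=
  (Ψ * Ψᴴ).trace.re - (Ψ * Ψᴴ * (Ψ * Ψᴴ)).trace.re / (Ψ * Ψᴴ).trace.re

/-- Cyclicity of the trace: the two reduced states of a bipartite pure state have the same purity.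
-/
theorem linearEntropy_conjTranspose (Ψ : Matrix α β ℂ) :
    linearEntropy Ψᴴ = linearEntropy Ψ := by
  have h : (Ψᴴ * Ψ * (Ψᴴ * Ψ)).trace = (Ψ * Ψᴴ * (Ψ * Ψᴴ)).trace := by
    rw [Matrix.mul_assoc, trace_mul_comm]
    simp only [Matrix.mul_assoc]
  rw [linearEntropy, linearEntropy, conjTranspose_conjTranspose, h, trace_mul_comm Ψᴴ Ψ]

/-- Homogeneity of degree one in `ΨΨᴴ` lets unnormalised branch vectors carry their own
probabilities. -/
theorem linearEntropy_smul (c : ℂ) (Ψ : Matrix α β ℂ) :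
    linearEntropy (c • Ψ) = ‖c‖ ^ 2 * linearEntropy Ψ := by
  have h : (c • Ψ) * (c • Ψ)ᴴ = ((‖c‖ ^ 2 : ℝ) : ℂ) • (Ψ * Ψᴴ) := by
    rw [conjTranspose_smul, Matrix.smul_mul, Matrix.mul_smul, smul_smul, Complex.star_def,
      Complex.mul_conj, Complex.normSq_eq_norm_sq]
  rw [linearEntropy, h, linearEntropy]
  simp only [Matrix.smul_mul, Matrix.mul_smul, trace_smul, smul_eq_mul, Complex.re_ofReal_mul]
  rcases eq_or_ne (‖c‖ ^ 2) 0 with h0 | h0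
  · simp [h0]
  · rw [mul_div_mul_left _ _ h0]
    ring

/-- A measurement on the rest preserves the average reduced state, so the trace terms add up exactly
and subadditivity handles the quotients. -/
theorem sum_linearEntropy_mul_right_le {γ : Type*} [Fintype γ] [DecidableEq β]
    (Ψ : Matrix α β ℂ) (L : ι → Matrix β γ ℂ) (hL : ∑ b, L b * (L b)ᴴ = 1) :
    ∑ b, linearEntropy (Ψ * L b) ≤ linearEntropy Ψ := by
  have hsum : ∑ b, (Ψ * L b) * (Ψ * L b)ᴴ = Ψ * Ψᴴ := by
    have : ∀ b, (Ψ * L b) * (Ψ * L b)ᴴ = Ψ * (L b * (L b)ᴴ) * Ψᴴ := fun b => by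
      simp only [conjTranspose_mul, Matrix.mul_assoc]
    simp_rw [this]
    rw [← Matrix.sum_mul, ← Matrix.mul_sum, hL, Matrix.mul_one]
  have h := trace_sq_div_trace_sum_le (fun b => (Ψ * L b) * (Ψ * L b)ᴴ)
    fun b => posSemidef_self_mul_conjTranspose _
  simp only [linearEntropy, Finset.sum_sub_distrib]
  rw [← Complex.re_sum, ← trace_sum, hsum]
  rw [hsum] at h
  linarith

theorem sum_linearEntropy_mul_left_le {γ : Type*} [Fintype γ] [DecidableEq α]
    (Ψ : Matrix α β ℂ) (K : ι → Matrix γ α ℂ) (hK : ∑ a, (K a)ᴴ * K a = 1) :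
    ∑ a, linearEntropy (K a * Ψ) ≤ linearEntropy Ψ := by
  have h := sum_linearEntropy_mul_right_le Ψᴴ (fun a => (K a)ᴴ)
    (by simpa only [conjTranspose_conjTranspose] using hK)
  simpa only [← conjTranspose_mul, linearEntropy_conjTranspose] using h

end Trace

/-! ### Optimal observables -/

/-- The witness is `diag(1, -1, 0, …) / √2`; in dimension one the only traceless matrix is zero. -/
theorem observables_nonempty {N : ℕ} {d : Fin N → ℕ} {j : Fin N} (hd : 2 ≤ d j) :
    (observables d j).Nonempty := by
  let a : Fin (d j) := ⟨0, by omega⟩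
  let b : Fin (d j) := ⟨1, by omega⟩
  have hab : a ≠ b := by simp [a, b]
  let s : ℝ := (√2)⁻¹
  have hs : s * s = 1 / 2 := by
    rw [← mul_inv, Real.mul_self_sqrt (by norm_num), one_div]
  have hsC : (s : ℂ) * s = 1 / 2 := by
    rw [← Complex.ofReal_mul, hs]
    norm_num
  let f : Fin (d j) → ℂ := fun x => (if x = a then (s : ℂ) else 0) - if x = b then (s : ℂ) else 0
  have hf : ∀ x, f x * f x = (if x = a then (1 / 2 : ℂ) else 0) + if x = b then 1 / 2 else 0 := by
    intro x
    simp only [f]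
    split_ifs with h₁ h₂ h₂
    · exact absurd (h₁.symm.trans h₂) hab
    · linear_combination hsC
    · linear_combination hsC
    · ring
  refine ⟨diagonal f, ?_, ?_, ?_⟩
  · refine isHermitian_diagonal_of_self_adjoint _ (funext fun x => ?_)
    simp only [f, Pi.star_apply, star_sub, apply_ite star, star_zero, Complex.star_def,
      Complex.conj_ofReal]
  · simp [f, trace_diagonal, Finset.sum_sub_distrib]
  · simp_rw [diagonal_mul_diagonal, trace_diagonal, hf, Finset.sum_add_distrib,
      Finset.sum_ite_eq', Finset.mem_univ, if_true]
    norm_num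

/-- The optimum is the normalised traceless part `M₀` of `M`, by Cauchy–Schwarz. Matrices with
nonzero trace are admitted because the state change at an outcome of probability zero is the reduced
state itself, of trace one for a unit vector. -/
theorem exists_optimal_observable {N : ℕ} {d : Fin N → ℕ} {j : Fin N} (hd : 2 ≤ d j)
    {M : Matrix (Fin (d j)) (Fin (d j)) ℂ} (hM : M.IsHermitian) :
    ∃ A ∈ observables d j, ∀ B ∈ observables d j,
      (M * B).trace.re ^ 2 ≤ (M * A).trace.re ^ 2 ∧
      (M.trace = 0 → (M * A).trace.re ^ 2 = (M * M).trace.re) := by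
  let c : ℝ := M.trace.re / d j
  have hdj : (d j : ℝ) ≠ 0 := by
    have : d j ≠ 0 := by omega
    exact_mod_cast this
  let M₀ : Matrix (Fin (d j)) (Fin (d j)) ℂ := M - (c : ℂ) • 1
  have hM₀ : M₀.IsHermitian := by
    refine hM.sub ?_
    rw [IsHermitian, conjTranspose_smul, conjTranspose_one, Complex.star_def, Complex.conj_ofReal]
  have htr : M₀.trace = 0 := by
    rw [trace_sub, trace_smul, trace_one, Fintype.card_fin, smul_eq_mul, sub_eq_zero,
      trace_eq_ofReal_re hM, ← Complex.ofReal_natCast, ← Complex.ofReal_mul, div_mul_cancel₀ _ hdj]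
  have hMB : ∀ B ∈ observables d j, (M * B).trace = (M₀ * B).trace := fun B hB => by
    simp [M₀, Matrix.sub_mul, hB.2.1]
  have bound : ∀ B ∈ observables d j, (M * B).trace.re ^ 2 ≤ (M₀ * M₀).trace.re := fun B hB => by
    rw [hMB B hB]
    set r := (M₀ * B).trace.re with hr
    have hH : (M₀ - (r : ℂ) • B).IsHermitian := by
      refine hM₀.sub ?_
      rw [IsHermitian, conjTranspose_smul, hB.1.eq, Complex.star_def, Complex.conj_ofReal]
    -- Cauchy–Schwarz: `0 ≤ ‖M₀ - rB‖² = ‖M₀‖² - r²`.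
    have h := trace_mul_self_re_nonneg hH
    have e : ((M₀ - (r : ℂ) • B) * (M₀ - (r : ℂ) • B)).trace.re =
        (M₀ * M₀).trace.re - r * r - r * (r - r) - r * r + r * r := by
      simp only [Matrix.sub_mul, Matrix.mul_sub, Matrix.smul_mul, Matrix.mul_smul, trace_sub,
        trace_smul, smul_eq_mul, trace_mul_comm B M₀, hB.2.2, Complex.sub_re,
        Complex.re_ofReal_mul, Complex.one_re, ← hr]
      ring
    nlinarith
  have attained : ∃ A ∈ observables d j, (M * A).trace.re ^ 2 = (M₀ * M₀).trace.re := by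
    -- If `M₀` has norm zero it cannot be normalised, but then every observable is optimal.
    rcases (trace_mul_self_re_nonneg hM₀).eq_or_lt with h | h
    · obtain ⟨A, hA⟩ := observables_nonempty hd
      exact ⟨A, hA, le_antisymm (bound A hA) (h ▸ sq_nonneg _)⟩
    · set q := (M₀ * M₀).trace.re with hq
      have hqC : (M₀ * M₀).trace = (q : ℂ) :=
        trace_eq_ofReal_re (by rw [IsHermitian, conjTranspose_mul, hM₀.eq])
      have hss : ((√q)⁻¹ * ((√q)⁻¹ * q) : ℝ) = 1 := by
        rw [← mul_assoc, ← mul_inv, Real.mul_self_sqrt h.le, inv_mul_cancel₀ h.ne']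
      have hA : (((√q)⁻¹ : ℝ) : ℂ) • M₀ ∈ observables d j := by
        refine ⟨?_, by rw [trace_smul, htr, smul_zero], ?_⟩
        · rw [IsHermitian, conjTranspose_smul, hM₀.eq, Complex.star_def, Complex.conj_ofReal]
        · rw [Matrix.smul_mul, Matrix.mul_smul, trace_smul, trace_smul, hqC, smul_eq_mul,
            smul_eq_mul, ← Complex.ofReal_mul, ← Complex.ofReal_mul, hss, Complex.ofReal_one]
      refine ⟨_, hA, ?_⟩
      rw [hMB _ hA, Matrix.mul_smul, trace_smul, smul_eq_mul, Complex.re_ofReal_mul, ← hq, mul_pow,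
        inv_pow, Real.sq_sqrt h.le, sq, inv_mul_cancel_left₀ h.ne']
  obtain ⟨A, hA, hAq⟩ := attained
  refine ⟨A, hA, fun B hB => ⟨hAq ▸ bound B hB, fun h0 => ?_⟩⟩
  have : M₀ = M := by simp [M₀, c, h0]
  rw [hAq, this]

variable {N : ℕ} {d m : Fin N → ℕ}

/-! ### Coefficient matrices with respect to the bipartition of party `j` and the rest -/

/-- The coefficient matrix of a vector with respect to the splitting into party `j` and the rest. -/
def coeffMatrix (j : Fin N) (ψ : Config d → ℂ) : Matrix (Fin (d j)) (RestConfig d j) ℂ :=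
  Matrix.of fun a r => ψ ((Equiv.piSplitAt j fun i => Fin (d i)).symm (a, r))

theorem sum_config {M : Type*} [AddCommMonoid M] (j : Fin N) (f : Config d → M) :
    ∑ x, f x = ∑ a, ∑ r, f ((Equiv.piSplitAt j fun i => Fin (d i)).symm (a, r)) := by
  rw [← Fintype.sum_prod_type', (Equiv.piSplitAt j fun i => Fin (d i)).symm.sum_comp]

theorem piSplitAt_symm_self (j : Fin N) (a : Fin (d j)) (r : RestConfig d j) :
    (Equiv.piSplitAt j fun i => Fin (d i)).symm (a, r) j = a :=
  congrArg Prod.fst ((Equiv.piSplitAt j fun i => Fin (d i)).apply_symm_apply (a, r))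

theorem rest_piSplitAt_symm (j : Fin N) (a : Fin (d j)) (r : RestConfig d j) :
    rest j ((Equiv.piSplitAt j fun i => Fin (d i)).symm (a, r)) = r :=
  congrArg Prod.snd ((Equiv.piSplitAt j fun i => Fin (d i)).apply_symm_apply (a, r))

/-- Partial trace: local expectation values see only the reduced state `ΨΨᴴ`. -/
theorem trace_ketbra_mul_onParty (j : Fin N) (ψ : EuclideanSpace ℂ (Config d))
    (A : Matrix (Fin (d j)) (Fin (d j)) ℂ) :
    (ketbra ψ * onParty j A).trace = (coeffMatrix j ψ * (coeffMatrix j ψ)ᴴ * A).trace := by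
  simp only [trace, diag_apply, mul_apply, ketbra, onParty, vecMulVec_apply, of_apply,
    sum_config j, piSplitAt_symm_self, rest_piSplitAt_symm, coeffMatrix, conjTranspose_apply,
    mul_ite, mul_zero, Finset.sum_ite_eq', Finset.mem_univ, if_true, Finset.sum_mul]
  refine Finset.sum_congr rfl fun a _ => ?_
  rw [Finset.sum_comm]

theorem trace_ketbra (j : Fin N) (ψ : EuclideanSpace ℂ (Config d)) :
    (ketbra ψ).trace = (coeffMatrix j ψ * (coeffMatrix j ψ)ᴴ).trace := by
  simp only [trace, diag_apply, mul_apply, ketbra, vecMulVec_apply,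
    sum_config j, coeffMatrix, conjTranspose_apply, of_apply]

/-- The rest labels the columns of `Ψ`, hence right multiplication by a transpose. -/
theorem coeffMatrix_onRest_mulVec (j : Fin N) (B : Matrix (RestConfig d j) (RestConfig d j) ℂ)
    (ψ : Config d → ℂ) : coeffMatrix j (onRest j B *ᵥ ψ) = coeffMatrix j ψ * Bᵀ := by
  ext a r
  simp only [coeffMatrix, of_apply, mulVec, dotProduct, onRest, sum_config j, piSplitAt_symm_self,
    rest_piSplitAt_symm, mul_apply, transpose_apply, ite_mul, zero_mul]
  rw [Finset.sum_comm]
  simp [mul_comm]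

/-- The tensor product of the local operators of all parties but `j`. -/
def restTensorOp (j : Fin N) (A : (i : Fin N) → Matrix (Fin (m i)) (Fin (d i)) ℂ) :
    Matrix (RestConfig m j) (RestConfig d j) ℂ :=
  Matrix.of fun r s => ∏ i, A i.1 (r i) (s i)

theorem coeffMatrix_tensorOp_mulVec (j : Fin N)
    (A : (i : Fin N) → Matrix (Fin (m i)) (Fin (d i)) ℂ) (ψ : Config d → ℂ) :
    coeffMatrix j (tensorOp A *ᵥ ψ) = A j * (coeffMatrix j ψ * (restTensorOp j A)ᵀ) := by
  have key : ∀ (x : Config m) (y : Config d), ∏ i, A i (x i) (y i) =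
      A j (x j) (y j) * restTensorOp j A (rest j x) (rest j y) := fun x y =>
    Fintype.prod_eq_mul_prod_subtype_ne (fun i => A i (x i) (y i)) j
  ext a r
  simp only [coeffMatrix, of_apply, mulVec, dotProduct, tensorOp, sum_config j, key,
    piSplitAt_symm_self, rest_piSplitAt_symm, mul_apply, transpose_apply, Finset.mul_sum]
  refine Finset.sum_congr rfl fun b _ => Finset.sum_congr rfl fun s _ => ?_
  ring

/-- Exchanging sums and products factorises each entry into the completeness relations of the single
parties. The tensor product is written out because `restTensorOp` would also ask for an operator of
party `j`. -/
theorem sum_restTensorOp_conjTranspose_mul_self {n : Fin N → ℕ} (j : Fin N)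
    (K : (i : Fin N) → Fin (n i) → Matrix (Fin (m i)) (Fin (d i)) ℂ)
    (hK : ∀ i, ∑ a, (K i a)ᴴ * K i a = 1) :
    ∑ b : (i : {i // i ≠ j}) → Fin (n i),
      (Matrix.of fun (r : RestConfig m j) (s : RestConfig d j) => ∏ i, K i.1 (b i) (r i) (s i))ᴴ *
      (Matrix.of fun (r : RestConfig m j) (s : RestConfig d j) => ∏ i, K i.1 (b i) (r i) (s i)) =
      1 := by
  ext s t
  have hK' : ∀ i : {i // i ≠ j}, ∑ a, ∑ r, star (K i.1 a r (s i)) * K i.1 a r (t i) =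
      if s i = t i then 1 else 0 := fun i => by
    have := congrFun₂ (hK i.1) (s i) (t i)
    simpa only [Matrix.sum_apply, mul_apply, conjTranspose_apply, one_apply] using this
  simp only [Matrix.sum_apply, mul_apply, conjTranspose_apply, of_apply, star_prod,
    ← Finset.prod_mul_distrib]
  have hp : ∀ b : (i : {i // i ≠ j}) → Fin (n i),
      ∑ r : RestConfig m j, ∏ i, (star (K i.1 (b i) (r i) (s i)) * K i.1 (b i) (r i) (t i)) =
      ∏ i, ∑ r, star (K i.1 (b i) r (s i)) * K i.1 (b i) r (t i) := fun b =>
    (Fintype.prod_sum fun (i : {i // i ≠ j}) (r : Fin (m i)) =>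
      star (K i.1 (b i) r (s i)) * K i.1 (b i) r (t i)).symm
  simp only [hp]
  rw [← Fintype.prod_sum fun (i : {i // i ≠ j}) (b : Fin (n i)) =>
      ∑ r, star (K i.1 b r (s i)) * K i.1 b r (t i)]
  simp only [hK', one_apply]
  by_cases h : s = t
  · simp [h]
  · obtain ⟨i, hi⟩ := Function.ne_iff.1 h
    rw [if_neg h]
    exact Finset.prod_eq_zero (Finset.mem_univ i) (if_neg hi)

theorem sum_linearEntropy_tensorOp_le {n : Fin N → ℕ} (j : Fin N)
    (K : (i : Fin N) → Fin (n i) → Matrix (Fin (m i)) (Fin (d i)) ℂ)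
    (hK : ∀ i, ∑ a, (K i a)ᴴ * K i a = 1) (ψ : Config d → ℂ) :
    ∑ a : (i : Fin N) → Fin (n i),
        linearEntropy (coeffMatrix j (tensorOp (fun i => K i (a i)) *ᵥ ψ)) ≤
      linearEntropy (coeffMatrix j ψ) := by
  let L : ((i : {i // i ≠ j}) → Fin (n i)) → Matrix (RestConfig m j) (RestConfig d j) ℂ :=
    fun b => Matrix.of fun r s => ∏ i, K i.1 (b i) (r i) (s i)
  have hL : ∑ b, (L b)ᵀ * ((L b)ᵀ)ᴴ = 1 := by
    have h := congrArg Matrix.transpose (sum_restTensorOp_conjTranspose_mul_self j K hK)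
    rw [transpose_sum, transpose_one] at h
    rw [← h]
    refine Finset.sum_congr rfl fun b _ => ?_
    rw [transpose_mul]
    rfl
  have hLa : ∀ a : (i : Fin N) → Fin (n i),
      restTensorOp j (fun i => K i (a i)) = L (rest j a) := fun a => rfl
  simp_rw [coeffMatrix_tensorOp_mulVec, hLa]
  -- For fixed results of the other parties, sum over the result of party `j` (left multiplication),
  -- and then over the others (right multiplication).
  rw [sum_config j, Finset.sum_comm]
  simp only [piSplitAt_symm_self, rest_piSplitAt_symm]
  exact (Finset.sum_le_sum fun b _ => sum_linearEntropy_mul_left_le _ (K j) (hK j)).trans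
    (sum_linearEntropy_mul_right_le _ _ hL)

/-! ### Departure from separability of a pure state -/

theorem sum_ketbra_orthonormalBasis {ι : Type} [Fintype ι] [DecidableEq ι]
    (χ : OrthonormalBasis ι ℂ (EuclideanSpace ℂ ι)) : ∑ i, ketbra (χ i) = 1 := by
  ext r s
  have h := χ.sum_inner_mul_inner (EuclideanSpace.single r 1) (EuclideanSpace.single s 1)
  simp only [EuclideanSpace.inner_single_left, EuclideanSpace.inner_single_right, map_one, one_mul,
    PiLp.single_apply, apply_ite (starRingEnd ℂ), map_zero, eq_comm (a := s)] at h
  simp only [Matrix.sum_apply, ketbra, vecMulVec_apply, one_apply]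
  exact h

theorem conjTranspose_ketbra {α : Type} (v : EuclideanSpace ℂ α) : (ketbra v)ᴴ = ketbra v := by
  rw [ketbra, conjTranspose_vecMulVec]
  congr 1
  funext x
  simp

theorem mul_ketbra_mul_conjTranspose {α β : Type} [Fintype α] (M : Matrix β α ℂ)
    (v : EuclideanSpace ℂ α) :
    M * ketbra v * Mᴴ = ketbra (WithLp.toLp 2 (M *ᵥ fun x => v x)) := by
  rw [ketbra, mul_vecMulVec, vecMulVec_mul]
  have : (fun x => star (v x)) ᵥ* Mᴴ = star (M *ᵥ fun x => v x) := (star_mulVec _ _).symm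
  rw [this]
  rfl

theorem trace_ketbra_of_norm_eq_one {α : Type} [Fintype α] {v : EuclideanSpace ℂ α}
    (hv : ‖v‖ = 1) : (ketbra v).trace = 1 := by
  have h := EuclideanSpace.norm_sq_eq v
  rw [hv] at h
  simp only [ketbra, trace_vecMulVec, dotProduct, Complex.star_def, Complex.mul_conj,
    Complex.normSq_eq_norm_sq]
  rw [← Complex.ofReal_sum, ← h]
  simp

theorem ketbra_mul_self {α : Type} [Fintype α] {v : EuclideanSpace ℂ α} (hv : ‖v‖ = 1) :
    ketbra v * ketbra v = ketbra v := by
  have h := trace_ketbra_of_norm_eq_one hv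
  rw [ketbra, trace_vecMulVec, dotProduct_comm] at h
  rw [ketbra, vecMulVec_mul_vecMulVec, h, one_smul]

theorem conjTranspose_onRest (j : Fin N) (B : Matrix (RestConfig d j) (RestConfig d j) ℂ) :
    (onRest j B)ᴴ = onRest j Bᴴ := by
  ext x y
  simp only [onRest, conjTranspose_apply, of_apply, apply_ite star, star_zero, eq_comm]

theorem onRest_mul_onRest (j : Fin N) (B C : Matrix (RestConfig d j) (RestConfig d j) ℂ) :
    onRest j B * onRest j C = onRest j (B * C) := by
  ext x y
  simp only [onRest, mul_apply, of_apply, sum_config j, piSplitAt_symm_self, rest_piSplitAt_symm]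
  rw [Finset.sum_comm]
  simp

section PureState

variable {j : Fin N} (ψ : EuclideanSpace ℂ (Config d)) (χ : RestMeasurement d j)
  (i : RestConfig d j)

theorem conjTranspose_projector : (projector χ i)ᴴ = projector χ i := by
  rw [projector, conjTranspose_onRest, conjTranspose_ketbra]

theorem projector_mul_self : projector χ i * projector χ i = projector χ i := by
  rw [projector, onRest_mul_onRest, ketbra_mul_self (χ.orthonormal.1 i)]

/-- The unnormalised state of party `j` after the outcome `i`. -/
def conditionalState : Matrix (Fin (d j)) (Fin (d j)) ℂ :=
  coeffMatrix j ψ * (ketbra (χ i))ᵀ * (coeffMatrix j ψ)ᴴ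

theorem projector_mul_ketbra_mul_projector :
    projector χ i * ketbra ψ * projector χ i =
      ketbra (WithLp.toLp 2 (projector χ i *ᵥ fun x => ψ x)) := by
  rw [← mul_ketbra_mul_conjTranspose, conjTranspose_projector]

theorem coeffMatrix_projector_mul_conjTranspose :
    coeffMatrix j (projector χ i *ᵥ fun x => ψ x) *
      (coeffMatrix j (projector χ i *ᵥ fun x => ψ x))ᴴ = conditionalState ψ χ i := by
  rw [projector, coeffMatrix_onRest_mulVec, conjTranspose_mul, Matrix.mul_assoc,
    ← Matrix.mul_assoc (ketbra (χ i))ᵀ, (IsHermitian.transpose (conjTranspose_ketbra (χ i))).eq,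
    ← transpose_mul, ketbra_mul_self (χ.orthonormal.1 i), ← Matrix.mul_assoc]
  rfl

theorem outcomeProb_ketbra : outcomeProb (ketbra ψ) χ i = (conditionalState ψ χ i).trace.re := by
  rw [outcomeProb, ← projector_mul_self, ← Matrix.mul_assoc, trace_mul_comm, ← Matrix.mul_assoc,
    projector_mul_ketbra_mul_projector, trace_ketbra j]
  congr 2
  exact coeffMatrix_projector_mul_conjTranspose ψ χ i

theorem isHermitian_conditionalState : (conditionalState ψ χ i).IsHermitian := by
  rw [← coeffMatrix_projector_mul_conjTranspose]
  exact isHermitian_mul_conjTranspose_self _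

/-- The measurement on the rest has rank one, so the conditional state is `w wᴴ` with `w = Ψ χ̄ᵢ`:
party `j` is left in a pure state. -/
theorem conditionalState_mul_self : conditionalState ψ χ i * conditionalState ψ χ i =
    (conditionalState ψ χ i).trace • conditionalState ψ χ i := by
  have h : conditionalState ψ χ i = vecMulVec (coeffMatrix j ψ *ᵥ star (fun x => χ i x))
      (star (coeffMatrix j ψ *ᵥ star (fun x => χ i x))) := by
    rw [conditionalState, ketbra, transpose_vecMulVec, mul_vecMulVec, vecMulVec_mul, star_mulVec,
      star_star]
    rfl
  rw [h, vecMulVec_mul_vecMulVec, trace_vecMulVec, dotProduct_comm, vecMulVec_smul]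

theorem sum_conditionalState :
    ∑ i, conditionalState ψ χ i = coeffMatrix j ψ * (coeffMatrix j ψ)ᴴ := by
  simp only [conditionalState]
  rw [← Matrix.sum_mul, ← Matrix.mul_sum, ← transpose_sum, sum_ketbra_orthonormalBasis,
    transpose_one, Matrix.mul_one]

/-- The difference of the reduced states of party `j` before and after the outcome `i`. -/
def stateChange : Matrix (Fin (d j)) (Fin (d j)) ℂ :=
  coeffMatrix j ψ * (coeffMatrix j ψ)ᴴ -
    (((outcomeProb (ketbra ψ) χ i)⁻¹ : ℝ) : ℂ) • conditionalState ψ χ i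

theorem isHermitian_stateChange : (stateChange ψ χ i).IsHermitian := by
  refine (isHermitian_mul_conjTranspose_self _).sub ?_
  rw [IsHermitian, conjTranspose_smul, (isHermitian_conditionalState ψ χ i).eq, Complex.star_def,
    Complex.conj_ofReal]

theorem disturbance_ketbra (A : Matrix (Fin (d j)) (Fin (d j)) ℂ) :
    disturbance (ketbra ψ) χ i A = (stateChange ψ χ i * A).trace.re ^ 2 := by
  have h : coeffMatrix j (WithLp.toLp 2 (projector χ i *ᵥ fun x => ψ x)) *
      (coeffMatrix j (WithLp.toLp 2 (projector χ i *ᵥ fun x => ψ x)))ᴴ =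
      conditionalState ψ χ i := coeffMatrix_projector_mul_conjTranspose ψ χ i
  rw [disturbance, postState, projector_mul_ketbra_mul_projector, Matrix.smul_mul, trace_smul,
    trace_ketbra_mul_onParty, trace_ketbra_mul_onParty, h, stateChange, Matrix.sub_mul, trace_sub,
    Matrix.smul_mul, trace_smul, Complex.sub_re, smul_eq_mul, Complex.re_ofReal_mul,
    Complex.smul_re, smul_eq_mul]

end PureState

theorem exists_maximal_disturbance {j : Fin N} (hd : 2 ≤ d j) (ψ : EuclideanSpace ℂ (Config d))
    (χ : RestMeasurement d j) (i : RestConfig d j) :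
    ∃ A ∈ observables d j, ∀ B ∈ observables d j,
      disturbance (ketbra ψ) χ i B ≤ disturbance (ketbra ψ) χ i A := by
  obtain ⟨A, hA, h⟩ := exists_optimal_observable hd (isHermitian_stateChange ψ χ i)
  refine ⟨A, hA, fun B hB => ?_⟩
  simpa only [disturbance_ketbra] using (h B hB).1

theorem iSup_disturbance_ketbra {j : Fin N} (hd : 2 ≤ d j) (ψ : EuclideanSpace ℂ (Config d))
    (χ : RestMeasurement d j) (i : RestConfig d j) (h0 : (stateChange ψ χ i).trace = 0) :
    ⨆ A : observables d j, disturbance (ketbra ψ) χ i A =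
      (stateChange ψ χ i * stateChange ψ χ i).trace.re := by
  obtain ⟨A, hA, h⟩ := exists_optimal_observable hd (isHermitian_stateChange ψ χ i)
  have : Nonempty (observables d j) := ⟨⟨A, hA⟩⟩
  have hmax : ∀ B : observables d j,
      disturbance (ketbra ψ) χ i B ≤ disturbance (ketbra ψ) χ i A := fun B => by
    simpa only [disturbance_ketbra] using (h B B.2).1
  rw [← (h A hA).2 h0, ← disturbance_ketbra]
  exact le_antisymm (ciSup_le hmax)
    (le_ciSup (f := fun B : observables d j => disturbance (ketbra ψ) χ i B)
      ⟨_, Set.forall_mem_range.2 hmax⟩ ⟨A, hA⟩)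

open scoped ComplexOrder in
/-- The departure from separability of a pure state does not depend on the measurement. -/
theorem departure_ketbra {j : Fin N} (hd : 2 ≤ d j) {ψ : EuclideanSpace ℂ (Config d)}
    (hψ : ‖ψ‖ = 1) (χ : RestMeasurement d j) :
    departure (ketbra ψ) χ = linearEntropy (coeffMatrix j ψ) := by
  set σ := coeffMatrix j ψ * (coeffMatrix j ψ)ᴴ with hσ
  have htr : σ.trace = 1 := by rw [hσ, ← trace_ketbra, trace_ketbra_of_norm_eq_one hψ]
  -- With `C` the conditional state, expand `p Tr (σ - C/p)²` using `Tr C² = p²`. This form has no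
  -- division, so it also covers `p = 0`, where `C = 0`.
  have key : ∀ i, outcomeProb (ketbra ψ) χ i *
      ⨆ A : observables d j, disturbance (ketbra ψ) χ i A =
      outcomeProb (ketbra ψ) χ i * ((σ * σ).trace.re + 1) -
        2 * (σ * conditionalState ψ χ i).trace.re := by
    intro i
    have hC : (conditionalState ψ χ i).trace = (outcomeProb (ketbra ψ) χ i : ℂ) := by
      rw [outcomeProb_ketbra]
      exact trace_eq_ofReal_re (isHermitian_conditionalState ψ χ i)
    by_cases hp : outcomeProb (ketbra ψ) χ i = 0
    · have h : conditionalState ψ χ i = 0 := by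
        rw [← coeffMatrix_projector_mul_conjTranspose] at hC ⊢
        rw [hp, Complex.ofReal_zero] at hC
        rw [trace_mul_conjTranspose_self_eq_zero_iff.1 hC, Matrix.zero_mul]
      simp [hp, h]
    · have hpC : (outcomeProb (ketbra ψ) χ i : ℂ) ≠ 0 := Complex.ofReal_ne_zero.2 hp
      rw [iSup_disturbance_ketbra hd]
      · simp only [stateChange, ← hσ, Matrix.sub_mul, Matrix.mul_sub, Matrix.smul_mul,
          Matrix.mul_smul, conditionalState_mul_self, trace_sub, trace_smul, hC, smul_eq_mul,
          trace_mul_comm (conditionalState ψ χ i) σ, Complex.sub_re, Complex.re_ofReal_mul,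
          Complex.ofReal_re]
        field_simp
        ring
      · rw [stateChange, ← hσ, trace_sub, htr, trace_smul, hC, smul_eq_mul, Complex.ofReal_inv,
          inv_mul_cancel₀ hpC, sub_self]
  -- As the conditional states sum to `σ`, the total is `Tr σ² + 1 - 2 Tr σ² = 1 - Tr σ²`.
  have hprob : ∑ i, outcomeProb (ketbra ψ) χ i = 1 := by
    simp only [outcomeProb_ketbra]
    rw [← Complex.re_sum, ← trace_sum, sum_conditionalState, ← hσ, htr, Complex.one_re]
  rw [departure, Finset.sum_congr rfl fun i _ => key i, Finset.sum_sub_distrib, ← Finset.sum_mul,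
    hprob, ← Finset.mul_sum, ← Complex.re_sum, ← trace_sum, ← Matrix.mul_sum,
    sum_conditionalState, linearEntropy, ← hσ, htr, Complex.one_re]
  ring

theorem iSup_departure_ketbra {j : Fin N} (hd : 2 ≤ d j) {ψ : EuclideanSpace ℂ (Config d)}
    (hψ : ‖ψ‖ = 1) :
    ⨆ χ : RestMeasurement d j, departure (ketbra ψ) χ = linearEntropy (coeffMatrix j ψ) := by
  have : Nonempty (RestMeasurement d j) := ⟨EuclideanSpace.basisFun _ _⟩
  simp only [departure_ketbra hd hψ, ciSup_const]

theorem maximaAttained_ketbra (hd : ∀ j, 2 ≤ d j) {ψ : EuclideanSpace ℂ (Config d)}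
    (hψ : ‖ψ‖ = 1) : MaximaAttained (ketbra ψ) := fun j =>
  ⟨exists_maximal_disturbance (hd j) ψ, EuclideanSpace.basisFun _ _, fun χ => by
    rw [departure_ketbra (hd j) hψ, departure_ketbra (hd j) hψ]⟩

/-! ### LOCC protocols acting on pure states -/

/-- The output of a protocol on a pure state is an ensemble of pure states, one for each branch,
and the linear entropy of each party does not increase on average over the branches. -/
theorem LOCC.exists_branches {X : Type} [DecidableEq X] {e : Fin N → ℕ} (P : LOCC X e d)
    (ψ : EuclideanSpace ℂ (Config d)) :
    ∃ (ι : Type) (_ : Fintype ι) (label : ι → X) (v : ι → EuclideanSpace ℂ (Config e)),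
      (∀ x, P.output x (ketbra ψ) = ∑ b, if label b = x then ketbra (v b) else 0) ∧
      ∀ j, ∑ b, linearEntropy (coeffMatrix j (v b)) ≤ linearEntropy (coeffMatrix j ψ) := by
  induction P with
  | done y => exact ⟨Unit, inferInstance, fun _ => y, fun _ => ψ, by simp [LOCC.output], by simp⟩
  | round m n K complete next ih =>
    -- The induction hypothesis is applied to the unnormalised vector after the first round; a
    -- branch is then a first-round result together with a branch of the continuation.
    choose ι hι label v hout hle using fun a =>
      ih a (WithLp.toLp 2 (tensorOp (fun j => K j (a j)) *ᵥ fun x => ψ x))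
    refine ⟨Σ a, ι a, inferInstance, fun b => label b.1 b.2, fun b => v b.1 b.2, fun x => ?_,
      fun j => ?_⟩
    · simp only [LOCC.output, mul_ketbra_mul_conjTranspose, hout, Fintype.sum_sigma]
    · rw [Fintype.sum_sigma]
      exact (Finset.sum_le_sum fun a _ => hle a j).trans
        (sum_linearEntropy_tensorOp_le j K complete ψ)

theorem star_dotProduct_ketbra_mulVec {α : Type} [Fintype α] (u v : EuclideanSpace ℂ α) :
    star (fun x => u x) ⬝ᵥ (ketbra v *ᵥ fun x => u x) = ((‖inner ℂ u v‖ ^ 2 : ℝ) : ℂ) := by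
  have h : inner ℂ u v = (fun x => v x) ⬝ᵥ star (fun x => u x) := rfl
  have h' : (fun x => star (v x)) ⬝ᵥ (fun x => u x) = star (inner ℂ u v) := by
    rw [h, ← star_dotProduct_star, star_star, dotProduct_comm]
    rfl
  rw [ketbra, vecMulVec_mulVec, h', ← Complex.normSq_eq_norm_sq, ← Complex.mul_conj, h]
  simp [dotProduct_smul, dotProduct_comm, mul_comm]

/-- The only ensembles that realise a pure state consist of multiples of that state. -/
theorem exists_smul_of_sum_ketbra {α ι : Type} [Fintype α] (s : Finset ι)
    (v : ι → EuclideanSpace ℂ α) {φ : EuclideanSpace ℂ α} (hφ : ‖φ‖ = 1) {p : ℝ}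
    (h : ∑ b ∈ s, ketbra (v b) = p • ketbra φ) :
    ∃ c : ι → ℂ, (∀ b ∈ s, v b = c b • φ) ∧ ∑ b ∈ s, ‖c b‖ ^ 2 = p := by
  have hv : ∀ b ∈ s, v b = inner ℂ φ (v b) • φ := by
    intro b hb
    -- Test the identity against the component `u` of `v b` orthogonal to `φ`. The right side
    -- vanishes, hence so does each nonnegative term on the left, and the term of `b` is `‖u‖⁴`.
    set u := v b - inner ℂ φ (v b) • φ with hu
    have hφφ : inner ℂ φ φ = (1 : ℂ) := by
      rw [inner_self_eq_norm_sq_to_K, hφ]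
      norm_num
    have huφ : inner ℂ u φ = (0 : ℂ) := by
      rw [← inner_conj_symm, hu, inner_sub_right, inner_smul_right, hφφ, mul_one, sub_self, map_zero]
    have huv : inner ℂ u (v b) = inner ℂ u u := by
      have : v b = u + inner ℂ φ (v b) • φ := by rw [hu, sub_add_cancel]
      conv_lhs => rw [this]
      rw [inner_add_right, inner_smul_right, huφ, mul_zero, add_zero]
    have hq := congrArg (fun M => star (fun x => u x) ⬝ᵥ (M *ᵥ fun x => u x)) h
    simp only [sum_mulVec, dotProduct_sum, smul_mulVec, dotProduct_smul,
      star_dotProduct_ketbra_mulVec, huφ, norm_zero] at hq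
    rw [← Complex.ofReal_sum] at hq
    have hz : ∑ b ∈ s, ‖inner ℂ u (v b)‖ ^ 2 = 0 := by
      refine Complex.ofReal_eq_zero.1 (hq.trans ?_)
      simp
    have hb0 := (Finset.sum_eq_zero_iff_of_nonneg fun b _ => sq_nonneg _).1 hz b hb
    rw [huv] at hb0
    have : u = 0 := inner_self_eq_zero.1 (norm_eq_zero.1 (pow_eq_zero_iff two_ne_zero |>.1 hb0))
    exact sub_eq_zero.1 this
  refine ⟨fun b => inner ℂ φ (v b), hv, ?_⟩
  -- Testing against `φ` itself gives the total weight `p`.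
  have hq := congrArg (fun M => star (fun x => φ x) ⬝ᵥ (M *ᵥ fun x => φ x)) h
  simp only [sum_mulVec, dotProduct_sum, smul_mulVec, dotProduct_smul,
    star_dotProduct_ketbra_mulVec] at hq
  rw [← Complex.ofReal_sum, inner_self_eq_norm_sq_to_K, hφ] at hq
  have := congrArg Complex.re hq
  simpa [← Complex.ofReal_pow] using this

/-- All branches reporting `x` are multiples of `φ x` with total weight `p x`, so by homogeneity
merging them leaves the average linear entropy unchanged. -/
theorem LOCC.sum_linearEntropy_le {X : Type} [Fintype X] [DecidableEq X] {e : Fin N → ℕ}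
    (P : LOCC X e d) (ψ : EuclideanSpace ℂ (Config d)) (p : X → ℝ)
    (φ : X → EuclideanSpace ℂ (Config e)) (hφ : ∀ x, ‖φ x‖ = 1)
    (h : ∀ x, P.output x (ketbra ψ) = p x • ketbra (φ x)) (j : Fin N) :
    ∑ x, p x * linearEntropy (coeffMatrix j (φ x)) ≤ linearEntropy (coeffMatrix j ψ) := by
  obtain ⟨ι, _, label, v, hout, hle⟩ := P.exists_branches ψ
  refine le_trans (le_of_eq ?_) (hle j)
  rw [← Finset.sum_fiberwise Finset.univ label]
  refine Finset.sum_congr rfl fun x _ => ?_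
  have hx := h x
  rw [hout, ← Finset.sum_filter] at hx
  obtain ⟨c, hc, hcp⟩ := exists_smul_of_sum_ketbra _ v (hφ x) hx
  rw [← hcp, Finset.sum_mul]
  refine Finset.sum_congr rfl fun b hb => ?_
  rw [hc b hb, ← linearEntropy_smul]
  rfl

/-- Nonnegative combinations of the linear entropies of the parties are monotone on average. -/
theorem LOCC.sum_weighted_linearEntropy_le {X : Type} [Fintype X] [DecidableEq X] {e : Fin N → ℕ}
    (P : LOCC X e d) (ψ : EuclideanSpace ℂ (Config d)) (p : X → ℝ)
    (φ : X → EuclideanSpace ℂ (Config e)) (hφ : ∀ x, ‖φ x‖ = 1)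
    (h : ∀ x, P.output x (ketbra ψ) = p x • ketbra (φ x)) {c : ℝ} (hc : 0 ≤ c) {w : Fin N → ℝ}
    (hw : ∀ j, 0 ≤ w j) :
    ∑ x, p x * (c * ∑ j, w j * linearEntropy (coeffMatrix j (φ x))) ≤
      c * ∑ j, w j * linearEntropy (coeffMatrix j ψ) := by
  have e : ∑ x, p x * (c * ∑ j, w j * linearEntropy (coeffMatrix j (φ x))) =
      c * ∑ j, w j * ∑ x, p x * linearEntropy (coeffMatrix j (φ x)) := by
    simp only [Finset.mul_sum]
    rw [Finset.sum_comm]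
    refine Finset.sum_congr rfl fun j _ => Finset.sum_congr rfl fun x _ => ?_
    ring
  rw [e]
  exact mul_le_mul_of_nonneg_left (Finset.sum_le_sum fun j _ =>
    mul_le_mul_of_nonneg_left (P.sum_linearEntropy_le ψ p φ hφ h j) (hw j)) hc

/-! ### Monotonicity of both measures -/

/-- The factor `1` is the weight expected by `LOCC.sum_weighted_linearEntropy_le`. -/
theorem generalEntanglement_ketbra (hd : ∀ j, 2 ≤ d j) {ψ : EuclideanSpace ℂ (Config d)}
    (hψ : ‖ψ‖ = 1) :
    generalEntanglement (ketbra ψ) = 1 / (N : ℝ) * ∑ j, 1 * linearEntropy (coeffMatrix j ψ) := by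
  simp only [generalEntanglement, iSup_departure_ketbra (hd _) hψ, one_mul]

theorem normalizedGeneralEntanglement_ketbra (hd : ∀ j, 2 ≤ d j)
    {ψ : EuclideanSpace ℂ (Config d)} (hψ : ‖ψ‖ = 1) :
    normalizedGeneralEntanglement (ketbra ψ) =
      1 / (N : ℝ) * ∑ j, (1 - 1 / (d j : ℝ))⁻¹ * linearEntropy (coeffMatrix j ψ) := by
  simp only [normalizedGeneralEntanglement, iSup_departure_ketbra (hd _) hψ]

theorem LOCC.ensemble_monotone {X : Type} [Fintype X] [DecidableEq X] (hd : ∀ j, 2 ≤ d j)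
    (P : LOCC X d d) {ψ : EuclideanSpace ℂ (Config d)} (hψ : ‖ψ‖ = 1) (p : X → ℝ)
    (φ : X → EuclideanSpace ℂ (Config d)) (hφ : ∀ x, ‖φ x‖ = 1)
    (h : ∀ x, P.output x (ketbra ψ) = p x • ketbra (φ x)) :
    ∑ x, p x * generalEntanglement (ketbra (φ x)) ≤ generalEntanglement (ketbra ψ) ∧
      ∑ x, p x * normalizedGeneralEntanglement (ketbra (φ x)) ≤
        normalizedGeneralEntanglement (ketbra ψ) := by
  have hN : 0 ≤ 1 / (N : ℝ) := by positivity
  refine ⟨?_, ?_⟩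
  · simp only [generalEntanglement_ketbra hd hψ, fun x => generalEntanglement_ketbra hd (hφ x)]
    exact P.sum_weighted_linearEntropy_le ψ p φ hφ h hN fun _ => zero_le_one
  · simp only [normalizedGeneralEntanglement_ketbra hd hψ,
      fun x => normalizedGeneralEntanglement_ketbra hd (hφ x)]
    refine P.sum_weighted_linearEntropy_le ψ p φ hφ h hN fun j => inv_nonneg.2 (sub_nonneg.2 ?_)
    have : (1 : ℝ) ≤ d j := by exact_mod_cast (by omega : 1 ≤ 2).trans (hd j)
    exact div_le_one_of_le₀ this (by positivity)

end GenEnt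

end

theorem theorem3 {N : ℕ} (d : Fin N → ℕ) (hd : ∀ j, 2 ≤ d j)
    (ψ : EuclideanSpace ℂ (GenEnt.Config d)) (hψ : ‖ψ‖ = 1) :
    -- the maxima that define General Entanglement exist
    GenEnt.MaximaAttained (GenEnt.ketbra ψ) ∧
    -- deterministic conversion of pure states by LOCC
    (∀ (P : GenEnt.LOCC Unit d d) (φ : EuclideanSpace ℂ (GenEnt.Config d)), ‖φ‖ = 1 →
      P.output () (GenEnt.ketbra ψ) = GenEnt.ketbra φ →
      GenEnt.generalEntanglement (GenEnt.ketbra φ) ≤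
          GenEnt.generalEntanglement (GenEnt.ketbra ψ) ∧
        GenEnt.normalizedGeneralEntanglement (GenEnt.ketbra φ) ≤
          GenEnt.normalizedGeneralEntanglement (GenEnt.ketbra ψ)) ∧
    -- conversion to an ensemble of pure states by LOCC
    (∀ (X : Type) [Fintype X] [DecidableEq X] (P : GenEnt.LOCC X d d) (p : X → ℝ)
      (φ : X → EuclideanSpace ℂ (GenEnt.Config d)),
      (∀ x, 0 ≤ p x) → (∀ x, ‖φ x‖ = 1) →
      (∀ x, P.output x (GenEnt.ketbra ψ) = p x • GenEnt.ketbra (φ x)) →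
      ∑ x, p x * GenEnt.generalEntanglement (GenEnt.ketbra (φ x)) ≤
          GenEnt.generalEntanglement (GenEnt.ketbra ψ) ∧
        ∑ x, p x * GenEnt.normalizedGeneralEntanglement (GenEnt.ketbra (φ x)) ≤
          GenEnt.normalizedGeneralEntanglement (GenEnt.ketbra ψ)) := by
  refine ⟨GenEnt.maximaAttained_ketbra hd hψ, fun P φ hφ h => ?_, ?_⟩
  -- Deterministic conversion is the ensemble case with a single outcome of probability one.
  · have := P.ensemble_monotone hd hψ (fun _ => 1) (fun _ => φ) (fun _ => hφ)
      fun _ => by rw [one_smul, ← h]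
    simpa using this
  · intro X _ _ P p φ _ hφ h
    exact P.ensemble_monotone hd hψ p φ hφ h
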